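/- **Theorem (Exact Quadrature Rules for Rational Functions).** Let $d,\tilde d\ge 0$ be integers, let $\epsilon_\pm,\tilde\epsilon_\pm\in\{0,1\}$, and let $\alpha_1,\dots,\alpha_d$ and $\tilde\alpha_1,\dots,\tilde\alpha_{\tilde d}$ be complex numbers with $0<|\alpha_r|<1$, $0<|\tilde\alpha_r|<1$, where in each of the two families the non-real parameters occur in complex conjugate pairs. Put $$d_\epsilon=\tfrac12(d-\epsilon_+-\epsilon_-),\qquad \tilde d_{\tilde\epsilon}=\tfrac12(\tilde d-\tilde\epsilon_+-\tilde\epsilon_-),\qquad u_\alpha(x)=\frac{1-\alpha^2}{1+2\alpha\cos x+\alpha^2},$$ and let $m$ be a positive integer with $m>\lceil d_\epsilon\rceil+\lceil\tilde d_{\tilde\epsilon}\rceil$. Then the following holds. 1. For each $\hat l\in\{0,\dots,m\}$ the equation $$2(m-d_\epsilon-\tilde d_{\tilde\epsilon})\,\xi+\sum_{r=1}^{d}\int_0^\xi u_{\alpha_r}(x)\,dx+\sum_{r=1}^{\tilde d}\int_0^\xi u_{\tilde\alpha_r}(x)\,dx=\pi(2\hat l+\epsilon_-+\tilde\epsilon_-)$$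 has a unique real solution $\xi=\xi_{\hat l}$, and $0\le\xi_0<\xi_1<\cdots<\xi_m\le\pi$. Moreover $\xi_0=0$ if and only if $\epsilon_-=\tilde\epsilon_-=0$, and $\xi_m=\pi$ if and only if $\epsilon_+=\tilde\epsilon_+=0$. 2. The Christoffel weights $$\hat\Delta_{\hat l}=\left(\tfrac12\right)^{(1-\epsilon_-)(1-\tilde\epsilon_-)\delta_{\hat l}+(1-\epsilon_+)(1-\tilde\epsilon_+)\delta_{m-\hat l}}\left(2(m-d_\epsilon-\tilde d_{\tilde\epsilon})+\sum_{r=1}^{d}u_{\alpha_r}(\xi_{\hat l})+\sum_{r=1}^{\tilde d}u_{\tilde\alpha_r}(\xi_{\hat l})\right)^{-1}$$ (with $\delta_0=1$ and $\delta_x=0$ for $x\ne0$) are real and positive, and so are the values $\rho(\xi_{\hat l})$ of the Chebyshev weight function $$\rho(\xi)=2^{\epsilon_++\epsilon_-}(1+\epsilon_+\cos\xi)(1-\epsilon_-\cos\xi).$$ 3. For every polynomial $f$ with complex coefficients and of degree at most $D=2(m-\tilde d_{\tilde\epsilon})-1$, the rational function $$R(\xi)=\frac{f(\cos\xi)}{\prod_{r=1}^{d}(1+2\alpha_r\cos\xi+\alpha_r^2)}$$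 is such that $R\rho$ is integrable on $[0,\pi]$, and $$\frac1{2\pi}\int_0^\pi R(\xi)\rho(\xi)\,d\xi=\sum_{\hat l=0}^{m}R(\xi_{\hat l})\,\rho(\xi_{\hat l})\,\hat\Delta_{\hat l}.$$ For instance, if $\tilde d=0$ and $\tilde\epsilon_\pm=1$ then $D=2m+1$ (Gauss-type rules). If $\epsilon_-=\tilde\epsilon_-=0$ or $\epsilon_+=\tilde\epsilon_+=0$, but not both, then exactly one endpoint of $[0,\pi]$ is a node (Radau-type rules), and if $\epsilon_\pm=\tilde\epsilon_\pm=0$ then both endpoints are nodes (Lobatto-type rules). -/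

import Mathlib

open scoped ComplexConjugate

noncomputable section

/-- Parameters of a Bernstein-Szegő family: signs `ε₊, ε₋ ∈ {0, 1}` and `d ≥ 0` parameters
`α₁, …, α_d` with `0 < |α_r| < 1`, the non-real ones occurring in complex conjugate pairs (the
family is invariant, with multiplicities, under complex conjugation). -/
structure BSParams where
  /-- the number of parameters `α_r` -/
  d : ℕ
  /-- `ε₊` -/
  epsPlus : ℕ
  /-- `ε₋` -/
  epsMinus : ℕ
  /-- the parameters `α_r` -/
  α : Fin d → ℂ
  epsPlus_mem : epsPlus = 0 ∨ epsPlus = 1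
  epsMinus_mem : epsMinus = 0 ∨ epsMinus = 1
  norm_pos : ∀ r, 0 < ‖α r‖
  norm_lt_one : ∀ r, ‖α r‖ < 1
  conj_pairs : ∃ σ : Equiv.Perm (Fin d), ∀ r, α (σ r) = conj (α r)

namespace BSParams

/-- `d_ε = (d - ε₊ - ε₋) / 2`, a half-integer `≥ -1`. -/
def dEps (P : BSParams) : ℝ := ((P.d : ℝ) - P.epsPlus - P.epsMinus) / 2

/-- The Chebyshev weight function `ρ(ξ) = 2^(ε₊ + ε₋) (1 + ε₊ cos ξ) (1 - ε₋ cos ξ)`. -/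
def rho (P : BSParams) (ξ : ℝ) : ℝ :=
  2 ^ (P.epsPlus + P.epsMinus) * (1 + P.epsPlus * Real.cos ξ) * (1 - P.epsMinus * Real.cos ξ)

/-- The rational function `R(ξ) = f(cos ξ) / ∏_r (1 + 2 α_r cos ξ + α_r²)`. -/
def ratFun (P : BSParams) (f : Polynomial ℂ) (ξ : ℝ) : ℂ :=
  f.eval (Real.cos ξ : ℂ) / ∏ r, (1 + 2 * P.α r * (Real.cos ξ : ℂ) + P.α r ^ 2)

end BSParams

/-- `u_α(x) = (1 - α²) / (1 + 2 α cos x + α²)`. -/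
def bsU (α : ℂ) (x : ℝ) : ℂ :=
  (1 - α ^ 2) / (1 + 2 * α * (Real.cos x : ℂ) + α ^ 2)

/-- `ξ` solves the transcendental equation of index `l`. The sums over the parameters are formally
complex (and real because of the conjugate pairs), so the equation is written in `ℂ`. -/
def IsNode (P Q : BSParams) (m l : ℕ) (ξ : ℝ) : Prop :=
  ((2 * ((m : ℝ) - P.dEps - Q.dEps) * ξ : ℝ) : ℂ)
      + ∑ r, (∫ x in (0 : ℝ)..ξ, bsU (P.α r) x)
      + ∑ r, (∫ x in (0 : ℝ)..ξ, bsU (Q.α r) x)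
    = ((Real.pi * (2 * l + P.epsMinus + Q.epsMinus) : ℝ) : ℂ)

/-- The Christoffel weight attached to the node `ξ` of index `l`. -/
def christoffelWeight (P Q : BSParams) (m l : ℕ) (ξ : ℝ) : ℂ :=
  (1 / 2) ^ ((1 - P.epsMinus) * (1 - Q.epsMinus) * (if l = 0 then 1 else 0)
      + (1 - P.epsPlus) * (1 - Q.epsPlus) * (if l = m then 1 else 0))
    * (((2 * ((m : ℝ) - P.dEps - Q.dEps) : ℝ) : ℂ)
        + ∑ r, bsU (P.α r) ξ + ∑ r, bsU (Q.α r) ξ)⁻¹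

end

/-!
With `z = e^(iξ)`, the exponential of `i ∫₀^ξ u_α` is the Blaschke factor `(z + α) / (1 + α z)`
(`exp_I_mul_integral_bsU`). So if `Φ(ξ)` denotes the left-hand side of the equation for the nodes,
`e^(iΦ)` is a finite Blaschke product of degree `N + d + d̃`, where `N = 2 (m - d_ε - d̃_ε̃)` is an
integer `≥ 2` (`BSParams.exists_exponent`, `BSParams.exp_phase_mul_I`). Since the parameters come in
conjugate pairs, the sum of the `u_α` is a sum of Poisson kernels (`BSParams.sum_bsU`), so that
`Φ' ≥ N > 0`. Hence `Φ` is an increasing bijection of the real line, it is odd, and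
`Φ(π) = π (N + d + d̃) = π (2 m + ε₊ + ε₋ + ε̃₊ + ε̃₋)`. This gives the existence, uniqueness,
ordering and location of the nodes and the positivity of the weights.

For the exactness, put `τ = e^(iπ(ε₋ + ε̃₋))`. The points of the circle where `e^(iΦ) = τ` are the
zeros of a monic polynomial of degree `N + d + d̃` (`BSParams.nodePoly`). There are as many such
points as its degree allows, so Lagrange interpolation at them gives a quadrature rule on the
circle, with weights `1 / Φ'`, for rational functions with denominator `z^(N-1) ∏ (1 + α z)(z + α)`;
see `BSParams.integral_circle_eq_sum`. The integrand `R ρ` has this form, and it is even. Folding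
the circle onto `[0, π]` turns the circle rule into the stated one: the nodes `0` and `π` are counted
once instead of twice, whence the factors `1 / 2`, and any of the points `0` and `π` at which
`e^(iΦ) = τ` but which is not a node is a zero of `ρ`
(`sum_Ico_eq_two_mul_sum_half_pow_mul`, `BSParams.integral_ratFun_mul_rho`).
-/

noncomputable section

/-! ### Lagrange sums, means over the circle, and polynomials in the cosine -/

open Polynomial in
theorem eq_nodal_of_monic {ι : Type*} {s : Finset ι} {v : ι → ℂ} (hv : Set.InjOn v s)
    {p : ℂ[X]} (hp : p.Monic) (hdeg : p.natDegree = s.card) (hroot : ∀ i ∈ s, p.eval (v i) = 0) :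
    p = Lagrange.nodal s v := by
  classical
  refine Polynomial.eq_of_degree_sub_lt_of_eval_index_eq s hv ?_ fun i hi => ?_
  · have h := Polynomial.degree_sub_lt_left (p := p) (q := Lagrange.nodal s v) ?_ hp.ne_zero ?_
    · rwa [Polynomial.degree_eq_natDegree hp.ne_zero, hdeg] at h
    · rw [Lagrange.degree_nodal, Polynomial.degree_eq_natDegree hp.ne_zero, hdeg]
    · rw [hp, (Lagrange.nodal_monic)]
  · rw [hroot i hi, Lagrange.eval_nodal_at_node hi]

open Polynomial in
/-- Lagrange interpolation at the zeros of `p`, read off at the coefficient of degree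
`s.card - 1`, which vanishes for `q`. -/
theorem sum_eval_div_derivative_eq_zero {ι : Type*} {s : Finset ι} {v : ι → ℂ}
    (hv : Set.InjOn v s) {p q : ℂ[X]} (hp : p.Monic) (hdeg : p.natDegree = s.card)
    (hroot : ∀ i ∈ s, p.eval (v i) = 0) (hq : q.natDegree + 1 < s.card) :
    ∑ i ∈ s, q.eval (v i) / p.derivative.eval (v i) = 0 := by
  classical
  have hdq : q.degree < s.card :=
    lt_of_le_of_lt Polynomial.degree_le_natDegree (by exact_mod_cast (by omega))
  have h := Lagrange.coeff_eq_sum hv hdq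
  rw [Polynomial.coeff_eq_zero_of_natDegree_lt (by omega)] at h
  rw [h]
  refine Finset.sum_congr rfl fun i hi => ?_
  rw [eq_nodal_of_monic hv hp hdeg hroot, Lagrange.eval_nodal_derivative_eval_node_eq hi,
    Lagrange.eval_nodal]

open Polynomial in
/-- Lagrange interpolation at the zeros of `p`, evaluated at `0`. -/
theorem sum_eval_div_mul_derivative {ι : Type*} {s : Finset ι} {v : ι → ℂ}
    (hv : Set.InjOn v s) {p q : ℂ[X]} (hp : p.Monic) (hdeg : p.natDegree = s.card)
    (hroot : ∀ i ∈ s, p.eval (v i) = 0) (hp0 : p.eval 0 ≠ 0) (hq : q.natDegree < s.card) :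
    ∑ i ∈ s, q.eval (v i) / (v i * p.derivative.eval (v i)) = -(q.eval 0 / p.eval 0) := by
  classical
  have hdq : q.degree < s.card :=
    lt_of_le_of_lt Polynomial.degree_le_natDegree (by exact_mod_cast hq)
  have hne : ∀ i ∈ s, (0 : ℂ) ≠ v i := fun i hi h => hp0 (h ▸ hroot i hi)
  have h := Lagrange.eval_interpolate_not_at_node (s := s) (v := v) (fun i => q.eval (v i)) hne
  rw [← Lagrange.eq_interpolate hv hdq, ← eq_nodal_of_monic hv hp hdeg hroot] at h
  rw [h, mul_div_cancel_left₀ _ hp0, ← Finset.sum_neg_distrib]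
  refine Finset.sum_congr rfl fun i hi => ?_
  rw [Lagrange.nodalWeight_eq_eval_derivative_nodal hi, ← eq_nodal_of_monic hv hp hdeg hroot]
  have := hne i hi
  rw [div_eq_mul_inv, mul_inv, zero_sub, inv_neg]
  ring

/-- The mean value property on the unit circle. -/
theorem integral_exp_mul_I_of_diffContOnCl {K : ℂ → ℂ}
    (hK : DiffContOnCl ℂ K (Metric.ball 0 1)) :
    ∫ x in (0 : ℝ)..2 * Real.pi, K (Complex.exp (x * Complex.I)) = 2 * Real.pi * K 0 := by
  have h := DiffContOnCl.circleAverage (c := 0) (R := 1) (f := K) (by simpa using hK)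
  rw [Real.circleAverage_def] at h
  simp only [circleMap, Complex.ofReal_one, one_mul, zero_add] at h
  rw [← h, Complex.real_smul]
  push_cast
  rw [mul_inv_cancel_left₀]
  exact_mod_cast Real.two_pi_pos.ne'

theorem integral_exp_neg_mul_I_of_diffContOnCl {K : ℂ → ℂ}
    (hK : DiffContOnCl ℂ K (Metric.ball 0 1)) :
    ∫ x in (0 : ℝ)..2 * Real.pi, K (Complex.exp (x * Complex.I))⁻¹ = 2 * Real.pi * K 0 := by
  rw [← integral_exp_mul_I_of_diffContOnCl hK]
  have h := intervalIntegral.integral_comp_sub_left (a := 0) (b := 2 * Real.pi)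
    (fun x : ℝ => K (Complex.exp (x * Complex.I))) (2 * Real.pi)
  simp only [sub_self, sub_zero] at h
  rw [← h]
  congr 1
  ext x
  rw [← Complex.exp_neg]
  congr 1
  rw [Complex.exp_eq_exp_iff_exists_int]
  exact ⟨-1, by push_cast; ring⟩

theorem integral_zero_pi_of_even_of_periodic {h : ℝ → ℂ} (hc : Continuous h)
    (heven : ∀ x, h (-x) = h x) (hper : ∀ x, h (x + 2 * Real.pi) = h x) :
    ∫ x in (0 : ℝ)..2 * Real.pi, h x = 2 * ∫ x in (0 : ℝ)..Real.pi, h x := by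
  rw [← intervalIntegral.integral_add_adjacent_intervals (b := Real.pi)
    (hc.intervalIntegrable _ _) (hc.intervalIntegrable _ _),
    two_mul (∫ x in (0 : ℝ)..Real.pi, h x)]
  congr 1
  have h1 := intervalIntegral.integral_comp_sub_left (a := 0) (b := Real.pi) h (2 * Real.pi)
  rw [sub_zero, show 2 * Real.pi - Real.pi = Real.pi by ring] at h1
  rw [← h1]
  congr 1
  ext x
  rw [show 2 * Real.pi - x = -x + 2 * Real.pi by ring, hper, heven]

open Polynomial in
/-- With `z = e^(ix)`, a polynomial in `cos x = (z + z⁻¹) / 2` of degree at most `M` is a Laurent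
polynomial in `z` with exponents in `[-M, M]`. -/
theorem exists_eval_cos_mul_pow (q : ℂ[X]) (M : ℕ) (hq : q.natDegree ≤ M) :
    ∃ G : ℂ[X], G.natDegree ≤ 2 * M ∧ ∀ x : ℝ,
      q.eval (Real.cos x : ℂ) * Complex.exp (x * Complex.I) ^ M
        = G.eval (Complex.exp (x * Complex.I)) := by
  refine ⟨∑ k ∈ Finset.range (M + 1),
    C (q.coeff k) * X ^ (M - k) * (C (1 / 2) * (X ^ 2 + 1)) ^ k, ?_, fun x => ?_⟩
  · refine natDegree_sum_le_of_forall_le _ _ fun k hk => ?_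
    have hk' : k ≤ M := by simpa [Nat.lt_succ_iff] using hk
    have h1 : ((C (1 / 2) * (X ^ 2 + 1)) ^ k : ℂ[X]).natDegree ≤ k * 2 :=
      natDegree_pow_le_of_le k (by compute_degree)
    have h2 : (C (q.coeff k) * X ^ (M - k) : ℂ[X]).natDegree ≤ M - k := by compute_degree
    exact (natDegree_mul_le_of_le h2 h1).trans (by omega)
  · rw [eval_eq_sum_range' (Nat.lt_succ_of_le hq), Finset.sum_mul, eval_finsetSum]
    refine Finset.sum_congr rfl fun k hk => ?_
    have hk' : k ≤ M := by simpa [Nat.lt_succ_iff] using hk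
    simp only [eval_mul, eval_C, eval_pow, eval_X, eval_add, eval_one]
    set z := Complex.exp (x * Complex.I) with hz
    have hz0 : z ≠ 0 := Complex.exp_ne_zero _
    have hcos : (1 / 2) * (z ^ 2 + 1) = (Real.cos x : ℂ) * z := by
      rw [Complex.ofReal_cos, Complex.cos, neg_mul, Complex.exp_neg, ← hz]
      field_simp
    rw [hcos, mul_pow]
    nth_rewrite 1 [← Nat.sub_add_cancel hk']
    rw [pow_add]; ring

open Polynomial in
/-- A Bezout identity with degree control: the factor `q` is reduced modulo `b`, and the degree of
`p` is then forced by that of `g`. It yields the partial fraction decomposition of `g / (a * b)`. -/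
theorem exists_mul_add_mul_eq {a b g : ℂ[X]} (hab : IsCoprime a b) (hb : b ≠ 0) {k : ℕ}
    (hb1 : 0 < b.natDegree) (hab' : a.natDegree ≤ k + 1) (hg : g.natDegree ≤ b.natDegree + k) :
    ∃ p q : ℂ[X], p * b + q * a = g ∧ p.natDegree ≤ k ∧ q.natDegree < b.natDegree := by
  obtain ⟨u, w, huw⟩ := hab
  have hq : (g * u % b).natDegree < b.natDegree := natDegree_mod_lt _ hb1.ne'
  have hid : (g * w + g * u / b * a) * b + g * u % b * a = g := by
    have := EuclideanDomain.div_add_mod (g * u) b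
    linear_combination a * this + g * huw
  refine ⟨_, _, hid, ?_, hq⟩
  set p := g * w + g * u / b * a
  by_cases hp : p = 0
  · simp [hp]
  have h1 : p * b = g - g * u % b * a :=
    eq_sub_of_add_eq hid
  have h2 : (p * b).natDegree ≤ b.natDegree + k := by
    rw [h1]
    refine (natDegree_sub_le _ _).trans (max_le hg ?_)
    exact natDegree_mul_le.trans (by omega)
  rw [natDegree_mul hp hb] at h2
  omega

/-! ### Blaschke factors -/

theorem one_add_mul_ne_zero_of_norm_lt {a z : ℂ} (ha : ‖a‖ < 1) (hz : ‖z‖ ≤ 1) :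
    1 + a * z ≠ 0 := by
  intro h
  have h1 : ‖a * z‖ = 1 := by
    rw [eq_neg_of_add_eq_zero_right h, norm_neg, norm_one]
  rw [norm_mul] at h1
  nlinarith [norm_nonneg a, norm_nonneg z]

theorem hasDerivAt_exp_ofReal_mul_I (x : ℝ) :
    HasDerivAt (fun x : ℝ => Complex.exp (x * Complex.I))
      (Complex.exp (x * Complex.I) * Complex.I) x := by
  have h := (Complex.ofRealCLM.hasDerivAt (x := x)).mul_const Complex.I
  simpa using h.cexp

theorem norm_exp_neg_ofReal_mul_I (x : ℝ) : ‖(Complex.exp (x * Complex.I))⁻¹‖ = 1 := by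
  rw [norm_inv, Complex.norm_exp_ofReal_mul_I, inv_one]

theorem two_mul_ofReal_cos (x : ℝ) : 2 * (Real.cos x : ℂ)
    = Complex.exp (x * Complex.I) + (Complex.exp (x * Complex.I))⁻¹ := by
  rw [Complex.ofReal_cos, Complex.cos, ← Complex.exp_neg, neg_mul]
  ring

theorem one_add_two_mul_cos_add_sq (a : ℂ) (x : ℝ) :
    1 + 2 * a * (Real.cos x : ℂ) + a ^ 2
      = (1 + a * Complex.exp (x * Complex.I)) * (1 + a * (Complex.exp (x * Complex.I))⁻¹) := by
  have h := two_mul_ofReal_cos x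
  have h0 := Complex.exp_ne_zero (x * Complex.I)
  rw [mul_assoc, mul_left_comm, h]
  field_simp
  ring

theorem one_add_two_mul_cos_add_sq_ne_zero {a : ℂ} (ha : ‖a‖ < 1) (x : ℝ) :
    1 + 2 * a * (Real.cos x : ℂ) + a ^ 2 ≠ 0 := by
  rw [one_add_two_mul_cos_add_sq]
  exact mul_ne_zero (one_add_mul_ne_zero_of_norm_lt ha (Complex.norm_exp_ofReal_mul_I x).le)
    (one_add_mul_ne_zero_of_norm_lt ha (norm_exp_neg_ofReal_mul_I x).le)

theorem continuous_bsU {a : ℂ} (ha : ‖a‖ < 1) : Continuous (bsU a) := by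
  unfold bsU
  refine Continuous.div (by fun_prop) (by fun_prop) fun x => ?_
  exact one_add_two_mul_cos_add_sq_ne_zero ha x

theorem bsU_neg (a : ℂ) (x : ℝ) : bsU a (-x) = bsU a x := by
  simp [bsU]

theorem bsU_add_two_pi (a : ℂ) (x : ℝ) : bsU a (x + 2 * Real.pi) = bsU a x := by
  rw [bsU, bsU, Real.cos_add_two_pi]

theorem bsU_eq {a : ℂ} (ha : ‖a‖ < 1) (x : ℝ) :
    bsU a x = (1 + a * Complex.exp (x * Complex.I))⁻¹
      + (1 + a * (Complex.exp (x * Complex.I))⁻¹)⁻¹ - 1 := by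
  have h1 := one_add_mul_ne_zero_of_norm_lt ha (Complex.norm_exp_ofReal_mul_I x).le
  have h2 := one_add_mul_ne_zero_of_norm_lt ha (norm_exp_neg_ofReal_mul_I x).le
  rw [bsU, one_add_two_mul_cos_add_sq]
  have h0 := Complex.exp_ne_zero (x * Complex.I)
  generalize Complex.exp (x * Complex.I) = z at *
  have h3 : z * z⁻¹ = 1 := mul_inv_cancel₀ h0
  rw [div_eq_iff (mul_ne_zero h1 h2)]
  generalize z⁻¹ = w at *
  field_simp
  linear_combination a ^ 2 * h3

theorem diffContOnCl_inv_one_add_mul {a : ℂ} (ha : ‖a‖ < 1) :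
    DiffContOnCl ℂ (fun z => (1 + a * z)⁻¹) (Metric.ball 0 1) := by
  apply DifferentiableOn.diffContOnCl
  rw [closure_ball _ one_ne_zero]
  intro z hz
  have h := one_add_mul_ne_zero_of_norm_lt ha (by simpa using hz : ‖z‖ ≤ 1)
  have hd : DifferentiableAt ℂ (fun z => 1 + a * z) z := by fun_prop
  exact (hd.inv h).differentiableWithinAt

/-- By evenness this is half of the integral over the circle, where each of the three terms of
`bsU_eq` has mean `±1`. -/
theorem integral_bsU_zero_pi {a : ℂ} (ha : ‖a‖ < 1) :
    ∫ x in (0 : ℝ)..Real.pi, bsU a x = Real.pi := by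
  have h := integral_zero_pi_of_even_of_periodic (continuous_bsU ha) (bsU_neg a)
    (bsU_add_two_pi a)
  have hK := diffContOnCl_inv_one_add_mul ha
  have hc1 : Continuous fun x : ℝ => (1 + a * Complex.exp (x * Complex.I))⁻¹ :=
    Continuous.inv₀ (by fun_prop)
      fun x => one_add_mul_ne_zero_of_norm_lt ha (Complex.norm_exp_ofReal_mul_I x).le
  have hc2 : Continuous fun x : ℝ => (1 + a * (Complex.exp (x * Complex.I))⁻¹)⁻¹ := by
    refine Continuous.inv₀ ?_
      fun x => one_add_mul_ne_zero_of_norm_lt ha (norm_exp_neg_ofReal_mul_I x).le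
    simp_rw [← Complex.exp_neg]
    fun_prop
  have h2 : ∫ x in (0 : ℝ)..2 * Real.pi, bsU a x = 2 * Real.pi := by
    simp_rw [bsU_eq ha]
    have hc3 : Continuous fun x : ℝ => (1 + a * Complex.exp (x * Complex.I))⁻¹
      + (1 + a * (Complex.exp (x * Complex.I))⁻¹)⁻¹ := hc1.add hc2
    rw [intervalIntegral.integral_sub (hc3.intervalIntegrable _ _)
        (continuous_const.intervalIntegrable _ _),
      intervalIntegral.integral_add (hc1.intervalIntegrable _ _) (hc2.intervalIntegrable _ _),
      integral_exp_mul_I_of_diffContOnCl hK, integral_exp_neg_mul_I_of_diffContOnCl hK]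
    simp
  rw [h2] at h
  linear_combination -h / 2

/-- The exponential of `i ∫₀^ξ u_a` is the Blaschke factor `(z + a) / (1 + a z)` at `z = e^(iξ)`:
the quotient of the two has derivative zero and equals `1` at `ξ = 0`. -/
theorem exp_I_mul_integral_bsU {a : ℂ} (ha : ‖a‖ < 1) (ξ : ℝ) :
    Complex.exp (Complex.I * ∫ x in (0 : ℝ)..ξ, bsU a x) * (1 + a * Complex.exp (ξ * Complex.I))
      = Complex.exp (ξ * Complex.I) + a := by
  have hz := hasDerivAt_exp_ofReal_mul_I
  have hne : ∀ x : ℝ, Complex.exp (x * Complex.I) + a ≠ 0 := fun x => by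
    have h := one_add_mul_ne_zero_of_norm_lt ha (norm_exp_neg_ofReal_mul_I x).le
    have h0 := Complex.exp_ne_zero (x * Complex.I)
    contrapose! h
    field_simp
    simpa using h
  have hI : ∀ x : ℝ, HasDerivAt (fun y : ℝ => ∫ x in (0 : ℝ)..y, bsU a x) (bsU a x) x := fun x =>
    intervalIntegral.integral_hasDerivAt_right ((continuous_bsU ha).intervalIntegrable _ _)
      ((continuous_bsU ha).stronglyMeasurableAtFilter _ _)
      (continuous_bsU ha).continuousAt
  have hF : ∀ x : ℝ, HasDerivAt (fun ξ : ℝ => Complex.exp (Complex.I * ∫ x in (0 : ℝ)..ξ, bsU a x)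
      * (1 + a * Complex.exp (ξ * Complex.I)) / (Complex.exp (ξ * Complex.I) + a)) 0 x := by
    intro x
    have h1 := (((hI x).const_mul Complex.I).cexp.mul (((hz x).const_mul a).const_add 1)).div
      ((hz x).add_const a) (hne x)
    refine h1.congr_deriv ?_
    have h2 := one_add_mul_ne_zero_of_norm_lt ha (Complex.norm_exp_ofReal_mul_I x).le
    have h3 := hne x
    have h0 := Complex.exp_ne_zero (x * Complex.I)
    have h4 : bsU a x = (1 - a ^ 2) * Complex.exp (x * Complex.I) /
        ((1 + a * Complex.exp (x * Complex.I)) * (Complex.exp (x * Complex.I) + a)) := by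
      rw [bsU, one_add_two_mul_cos_add_sq]
      field_simp
    rw [h4]
    simp only [Pi.mul_apply]
    generalize Complex.exp (Complex.I * ∫ x in (0 : ℝ)..x, bsU a x) = E
    generalize Complex.exp (x * Complex.I) = z at h0 h2 h3 ⊢
    field_simp
    ring
  have hconst := is_const_of_deriv_eq_zero (fun x => (hF x).differentiableAt)
    (fun x => (hF x).deriv) ξ 0
  have h5 : (1 + a) ≠ 0 := by simpa using hne 0
  simp only [intervalIntegral.integral_same, mul_zero, Complex.exp_zero, Complex.ofReal_zero,
    zero_mul, one_mul, mul_one, div_self h5] at hconst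
  rwa [div_eq_iff (hne ξ), one_mul] at hconst

/-! ### The polynomials and the density of a family of parameters -/

namespace BSParams

open Polynomial

/-- The polynomial `∏ r, (1 + α r * X)`. -/
def den (P : BSParams) : ℂ[X] := ∏ r, (1 + C (P.α r) * X)

/-- The reciprocal polynomial `∏ r, (X + α r)` of `P.den`. -/
def num (P : BSParams) : ℂ[X] := ∏ r, (X + C (P.α r))

/-- The density `∑ r, (1 - |α r|²) / |1 + α r * e^(ix)|²`, a sum of Poisson kernels. -/
def density (P : BSParams) (x : ℝ) : ℝ :=
  ∑ r, (1 - ‖P.α r‖ ^ 2) / ‖1 + P.α r * Complex.exp (x * Complex.I)‖ ^ 2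

variable (P : BSParams)

theorem eval_den (z : ℂ) : P.den.eval z = ∏ r, (1 + P.α r * z) := by
  simp [den, eval_prod]

theorem eval_num (z : ℂ) : P.num.eval z = ∏ r, (z + P.α r) := by
  simp [num, eval_prod]

theorem eval_den_zero : P.den.eval 0 = 1 := by
  simp [eval_den]

theorem eval_den_ne_zero {z : ℂ} (hz : ‖z‖ ≤ 1) : P.den.eval z ≠ 0 := by
  rw [eval_den]
  exact Finset.prod_ne_zero_iff.2 fun r _ =>
    one_add_mul_ne_zero_of_norm_lt (P.norm_lt_one r) hz

theorem eval_num_eq {z : ℂ} (hz : z ≠ 0) : P.num.eval z = z ^ P.d * P.den.eval z⁻¹ := by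
  have h : z ^ P.d = ∏ _r : Fin P.d, z := by simp
  rw [eval_num, eval_den, h, ← Finset.prod_mul_distrib]
  refine Finset.prod_congr rfl fun r _ => ?_
  field_simp

theorem eval_num_ne_zero {z : ℂ} (hz : 1 ≤ ‖z‖) : P.num.eval z ≠ 0 := by
  have h0 : z ≠ 0 := fun h => by norm_num [h] at hz
  rw [eval_num_eq P h0]
  exact mul_ne_zero (pow_ne_zero _ h0)
    (P.eval_den_ne_zero (by rw [norm_inv]; exact inv_le_one_of_one_le₀ hz))

theorem num_monic : P.num.Monic :=
  monic_prod_of_monic _ _ fun _ _ => monic_X_add_C _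

theorem natDegree_num : P.num.natDegree = P.d := by
  rw [num, natDegree_prod_of_monic _ _ fun _ _ => monic_X_add_C _]
  simp

theorem natDegree_den_le : P.den.natDegree ≤ P.d := by
  refine (natDegree_prod_le _ _).trans ?_
  refine (Finset.sum_le_card_nsmul _ _ 1 fun r _ => ?_).trans (by simp)
  compute_degree

theorem isCoprime_den_X_pow_mul_num (k : ℕ) : IsCoprime P.den (X ^ k * P.num) := by
  rw [isCoprime_iff_aeval_ne_zero_of_isAlgClosed ℂ ℂ]
  intro z
  simp only [coe_aeval_eq_eval]
  rcases le_total ‖z‖ 1 with hz | hz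
  · exact Or.inl (P.eval_den_ne_zero hz)
  · refine Or.inr ?_
    have h0 : z ≠ 0 := fun h => by norm_num [h] at hz
    rw [eval_mul, eval_pow, eval_X]
    exact mul_ne_zero (pow_ne_zero _ h0) (P.eval_num_ne_zero hz)

theorem prod_one_add_two_mul_cos_add_sq (x : ℝ) :
    (∏ r, (1 + 2 * P.α r * (Real.cos x : ℂ) + P.α r ^ 2)) * Complex.exp (x * Complex.I) ^ P.d
      = P.den.eval (Complex.exp (x * Complex.I)) * P.num.eval (Complex.exp (x * Complex.I)) := by
  simp_rw [one_add_two_mul_cos_add_sq]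
  rw [Finset.prod_mul_distrib, eval_num_eq P (Complex.exp_ne_zero _), eval_den, eval_den]
  ring

theorem prod_one_add_two_mul_cos_add_sq_ne_zero (x : ℝ) :
    ∏ r, (1 + 2 * P.α r * (Real.cos x : ℂ) + P.α r ^ 2) ≠ 0 :=
  Finset.prod_ne_zero_iff.2 fun r _ => one_add_two_mul_cos_add_sq_ne_zero (P.norm_lt_one r) x

/-- The conjugate pairs make the sum of the `u_α` real: it is a sum of Poisson kernels. -/
theorem sum_bsU (x : ℝ) : ∑ r, bsU (P.α r) x = (P.density x : ℂ) := by
  obtain ⟨σ, hσ⟩ := P.conj_pairs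
  set z := Complex.exp (x * Complex.I) with hz
  have hzc : z⁻¹ = conj z := by
    rw [hz, ← Complex.exp_conj, ← Complex.exp_neg]
    simp
  have h1 : ∑ r, (1 + P.α r * z⁻¹)⁻¹ = ∑ r, conj ((1 + P.α r * z)⁻¹) := by
    rw [← Equiv.sum_comp σ]
    refine Finset.sum_congr rfl fun r _ => ?_
    rw [hσ, hzc]
    simp
  have h2 : ∑ r, bsU (P.α r) x
      = ∑ r, ((1 + P.α r * z)⁻¹ + conj ((1 + P.α r * z)⁻¹) - 1) := by
    simp_rw [fun r => bsU_eq (P.norm_lt_one r) x]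
    rw [Finset.sum_sub_distrib, Finset.sum_add_distrib, h1, Finset.sum_sub_distrib,
      Finset.sum_add_distrib]
  rw [h2, density, Complex.ofReal_sum]
  refine Finset.sum_congr rfl fun r _ => ?_
  have hne : 1 + P.α r * z ≠ 0 := one_add_mul_ne_zero_of_norm_lt (P.norm_lt_one r)
    (Complex.norm_exp_ofReal_mul_I x).le
  have hne' : 1 + conj (P.α r) * conj z ≠ 0 := by simpa using (_root_.map_ne_zero conj).2 hne
  have hzz : z * conj z = 1 := by rw [← hzc, mul_inv_cancel₀ (Complex.exp_ne_zero _)]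
  push_cast
  rw [← Complex.mul_conj', ← Complex.mul_conj']
  simp only [map_inv₀, map_add, map_mul, map_one]
  generalize conj (P.α r) = b at *
  generalize conj z = w at *
  rw [eq_div_iff (mul_ne_zero hne hne')]
  field_simp
  linear_combination -(P.α r * b) * hzz

theorem density_nonneg (x : ℝ) : 0 ≤ P.density x := by
  refine Finset.sum_nonneg fun r _ => div_nonneg ?_ (by positivity)
  nlinarith [P.norm_lt_one r, norm_nonneg (P.α r)]

theorem continuous_density : Continuous P.density := by
  refine continuous_finsetSum _ fun r _ => Continuous.div (by fun_prop) (by fun_prop) fun x => ?_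
  exact pow_ne_zero _ (norm_ne_zero_iff.2 (one_add_mul_ne_zero_of_norm_lt (P.norm_lt_one r)
    (Complex.norm_exp_ofReal_mul_I x).le))

theorem density_neg (x : ℝ) : P.density (-x) = P.density x := by
  have : (P.density (-x) : ℂ) = P.density x := by
    simp_rw [← sum_bsU, bsU_neg]
  exact_mod_cast this

theorem sum_integral_bsU (ξ : ℝ) :
    ∑ r, (∫ x in (0 : ℝ)..ξ, bsU (P.α r) x) = ((∫ x in (0 : ℝ)..ξ, P.density x : ℝ) : ℂ) := by
  rw [← intervalIntegral.integral_ofReal, ← intervalIntegral.integral_finsetSum fun r _ =>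
    (continuous_bsU (P.norm_lt_one r)).intervalIntegrable _ _]
  simp_rw [sum_bsU]

theorem integral_density_zero_pi : ∫ x in (0 : ℝ)..Real.pi, P.density x = Real.pi * P.d := by
  have h := P.sum_integral_bsU Real.pi
  simp_rw [fun r => integral_bsU_zero_pi (P.norm_lt_one r)] at h
  rw [Finset.sum_const, Finset.card_univ, Fintype.card_fin, nsmul_eq_mul, mul_comm] at h
  exact_mod_cast h.symm

theorem integral_density_neg (ξ : ℝ) :
    ∫ x in (0 : ℝ)..-ξ, P.density x = -∫ x in (0 : ℝ)..ξ, P.density x := by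
  have h := intervalIntegral.integral_comp_neg (a := 0) (b := ξ) P.density
  simp_rw [density_neg, neg_zero] at h
  rw [h, intervalIntegral.integral_symm]

/-- The product of the Blaschke factors of the family. -/
theorem exp_integral_density_mul_I (ξ : ℝ) :
    Complex.exp ((∫ x in (0 : ℝ)..ξ, P.density x : ℝ) * Complex.I)
        * P.den.eval (Complex.exp (ξ * Complex.I))
      = P.num.eval (Complex.exp (ξ * Complex.I)) := by
  rw [← sum_integral_bsU, Finset.sum_mul, Complex.exp_sum, eval_den, eval_num,
    ← Finset.prod_mul_distrib]
  refine Finset.prod_congr rfl fun r _ => ?_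
  rw [mul_comm _ Complex.I, exp_I_mul_integral_bsU (P.norm_lt_one r)]

end BSParams

/-! ### The phase and quadrature on the circle -/

namespace BSParams

/-- The phase `Φ(ξ) = N ξ + ∑ ∫₀^ξ u_α + ∑ ∫₀^ξ u_α̃`; for `z = e^(iξ)`, `e^(iΦ(ξ))` is the
Blaschke product `z^N ∏ (z + α) / (1 + α z) ∏ (z + α̃) / (1 + α̃ z)`. -/
def phase (P Q : BSParams) (N : ℕ) (ξ : ℝ) : ℝ :=
  N * ξ + (∫ x in (0 : ℝ)..ξ, P.density x) + ∫ x in (0 : ℝ)..ξ, Q.density x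

/-- The derivative of the phase. -/
def phaseDeriv (P Q : BSParams) (N : ℕ) (ξ : ℝ) : ℝ :=
  N + P.density ξ + Q.density ξ

variable (P Q : BSParams) (N : ℕ)

theorem hasDerivAt_integral_density (ξ : ℝ) :
    HasDerivAt (fun ξ => ∫ x in (0 : ℝ)..ξ, P.density x) (P.density ξ) ξ :=
  intervalIntegral.integral_hasDerivAt_right (P.continuous_density.intervalIntegrable _ _)
    (P.continuous_density.stronglyMeasurableAtFilter _ _) P.continuous_density.continuousAt

theorem hasDerivAt_phase (ξ : ℝ) : HasDerivAt (phase P Q N) (phaseDeriv P Q N ξ) ξ := by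
  have h := (((hasDerivAt_id ξ).const_mul (N : ℝ)).add (P.hasDerivAt_integral_density ξ)).add
    (Q.hasDerivAt_integral_density ξ)
  rw [mul_one] at h
  exact h

theorem le_phaseDeriv (ξ : ℝ) : (N : ℝ) ≤ phaseDeriv P Q N ξ := by
  have h1 := P.density_nonneg ξ
  have h2 := Q.density_nonneg ξ
  unfold phaseDeriv
  linarith

theorem phaseDeriv_neg (ξ : ℝ) : phaseDeriv P Q N (-ξ) = phaseDeriv P Q N ξ := by
  simp [phaseDeriv, density_neg]

theorem phase_zero : phase P Q N 0 = 0 := by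
  simp [phase]

theorem phase_pi : phase P Q N Real.pi = Real.pi * (N + P.d + Q.d : ℕ) := by
  rw [phase, integral_density_zero_pi, integral_density_zero_pi]
  push_cast
  ring

theorem phase_neg (ξ : ℝ) : phase P Q N (-ξ) = -phase P Q N ξ := by
  rw [phase, integral_density_neg, integral_density_neg, phase]
  ring

variable {N}

theorem phaseDeriv_pos (hN : 0 < N) (ξ : ℝ) : 0 < phaseDeriv P Q N ξ :=
  lt_of_lt_of_le (by exact_mod_cast hN) (le_phaseDeriv P Q N ξ)

theorem strictMono_phase (hN : 0 < N) : StrictMono (phase P Q N) :=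
  strictMono_of_deriv_pos fun x => by
    rw [(hasDerivAt_phase P Q N x).deriv]
    exact phaseDeriv_pos P Q hN x

theorem continuous_phase : Continuous (phase P Q N) :=
  continuous_iff_continuousAt.2 fun x => (hasDerivAt_phase P Q N x).continuousAt

theorem le_phase {ξ : ℝ} (hξ : 0 ≤ ξ) : N * ξ ≤ phase P Q N ξ := by
  have h1 := intervalIntegral.integral_nonneg (μ := MeasureTheory.volume) hξ
    fun x _ => P.density_nonneg x
  have h2 := intervalIntegral.integral_nonneg (μ := MeasureTheory.volume) hξ
    fun x _ => Q.density_nonneg x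
  unfold phase
  linarith

theorem surjective_phase (hN : 0 < N) : Function.Surjective (phase P Q N) := by
  have hN' : (0 : ℝ) < N := by exact_mod_cast hN
  have htop : Filter.Tendsto (phase P Q N) Filter.atTop Filter.atTop := by
    refine Filter.tendsto_atTop_mono' _ ?_ (Filter.tendsto_id.const_mul_atTop hN')
    filter_upwards [Filter.eventually_ge_atTop 0] with x hx using le_phase P Q hx
  refine (continuous_phase P Q).surjective htop ?_
  have h := (Filter.tendsto_neg_atTop_atBot.comp htop).comp Filter.tendsto_neg_atBot_atTop
  refine h.congr fun x => ?_
  simp [phase_neg]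

variable (N)

theorem exp_phase_mul_I (ξ : ℝ) :
    Complex.exp (phase P Q N ξ * Complex.I) * (P.den.eval (Complex.exp (ξ * Complex.I))
        * Q.den.eval (Complex.exp (ξ * Complex.I)))
      = Complex.exp (ξ * Complex.I) ^ N * (P.num.eval (Complex.exp (ξ * Complex.I))
        * Q.num.eval (Complex.exp (ξ * Complex.I))) := by
  rw [← exp_integral_density_mul_I, ← exp_integral_density_mul_I, phase, ← Complex.exp_nat_mul,
    Complex.ofReal_add, Complex.ofReal_add, add_mul, add_mul, Complex.exp_add, Complex.exp_add]
  push_cast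
  rw [mul_assoc (N : ℂ)]
  ring

open Polynomial

/-- The polynomial whose zeros are the points `e^(iξ)` with `e^(iΦ(ξ)) = τ`. -/
def nodePoly (τ : ℂ) : ℂ[X] := X ^ N * (P.num * Q.num) - C τ * (P.den * Q.den)

variable (τ : ℂ)

theorem natDegree_X_pow_mul_num : (X ^ N * (P.num * Q.num)).natDegree = N + P.d + Q.d := by
  rw [(monic_X_pow N).natDegree_mul (P.num_monic.mul Q.num_monic), natDegree_X_pow,
    P.num_monic.natDegree_mul Q.num_monic, natDegree_num, natDegree_num, add_assoc]

theorem natDegree_C_mul_den_le : (C τ * (P.den * Q.den)).natDegree ≤ P.d + Q.d :=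
  (natDegree_C_mul_le _ _).trans
    (natDegree_mul_le_of_le P.natDegree_den_le Q.natDegree_den_le)

variable {N}

theorem degree_C_mul_den_lt (hN : 0 < N) :
    (C τ * (P.den * Q.den)).degree < (X ^ N * (P.num * Q.num)).degree := by
  have hmon : (X ^ N * (P.num * Q.num)).Monic :=
    (monic_X_pow N).mul (P.num_monic.mul Q.num_monic)
  rw [degree_eq_natDegree hmon.ne_zero, natDegree_X_pow_mul_num]
  refine lt_of_le_of_lt degree_le_natDegree ?_
  have h1 : (C τ * (P.den * Q.den)).natDegree ≤ P.d + Q.d := natDegree_C_mul_den_le P Q τ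
  exact_mod_cast (by omega)

theorem nodePoly_monic (hN : 0 < N) : (nodePoly P Q N τ).Monic :=
  ((monic_X_pow N).mul (P.num_monic.mul Q.num_monic)).sub_of_left
    (degree_C_mul_den_lt P Q τ hN)

theorem natDegree_nodePoly (hN : 0 < N) : (nodePoly P Q N τ).natDegree = N + P.d + Q.d := by
  rw [nodePoly, natDegree_sub_eq_left_of_natDegree_lt, natDegree_X_pow_mul_num]
  rw [natDegree_X_pow_mul_num]
  have h1 : (C τ * (P.den * Q.den)).natDegree ≤ P.d + Q.d := natDegree_C_mul_den_le P Q τ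
  omega

theorem eval_nodePoly_zero (hN : 0 < N) : (nodePoly P Q N τ).eval 0 = -τ := by
  simp [nodePoly, eval_den_zero, hN.ne']

variable (N)

theorem eval_nodePoly (ξ : ℝ) :
    (nodePoly P Q N τ).eval (Complex.exp (ξ * Complex.I))
      = (P.den.eval (Complex.exp (ξ * Complex.I)) * Q.den.eval (Complex.exp (ξ * Complex.I)))
        * (Complex.exp (phase P Q N ξ * Complex.I) - τ) := by
  rw [mul_sub, mul_comm _ (Complex.exp (phase P Q N ξ * Complex.I)), exp_phase_mul_I]
  simp only [nodePoly, eval_sub, eval_mul, eval_pow, eval_X, eval_C]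
  ring

theorem exp_mul_eval_derivative_nodePoly {ξ : ℝ}
    (hξ : Complex.exp (phase P Q N ξ * Complex.I) = τ) :
    Complex.exp (ξ * Complex.I) * (nodePoly P Q N τ).derivative.eval (Complex.exp (ξ * Complex.I))
      = phaseDeriv P Q N ξ * τ * (P.den.eval (Complex.exp (ξ * Complex.I))
        * Q.den.eval (Complex.exp (ξ * Complex.I))) := by
  -- differentiate the factorization `eval_nodePoly`, whose second factor vanishes at `ξ`
  have hp : ∀ p : ℂ[X], HasDerivAt (fun x : ℝ => p.eval (Complex.exp (x * Complex.I)))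
      (p.derivative.eval (Complex.exp (ξ * Complex.I)) * (Complex.exp (ξ * Complex.I) * Complex.I))
      ξ := fun p => (p.hasDerivAt _).comp ξ
        (hasDerivAt_exp_ofReal_mul_I ξ)
  have hph : HasDerivAt (fun x : ℝ => Complex.exp (phase P Q N x * Complex.I) - τ)
      (Complex.exp (phase P Q N ξ * Complex.I) * (phaseDeriv P Q N ξ * Complex.I)) ξ :=
    (((hasDerivAt_phase P Q N ξ).ofReal_comp).mul_const Complex.I).cexp.sub_const τ
  have h1 := ((hp P.den).mul (hp Q.den)).mul hph
  have h2 := hp (nodePoly P Q N τ)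
  simp_rw [eval_nodePoly] at h2
  have h3 := h2.unique h1
  simp only [Pi.mul_apply] at h3
  rw [hξ, sub_self, mul_zero, zero_add] at h3
  apply mul_right_cancel₀ Complex.I_ne_zero
  linear_combination h3

variable {N τ}

theorem eval_reflect_inv_mul_pow {z : ℂ} (hz : z ≠ 0) {q : ℂ[X]} {M : ℕ} (hq : q.natDegree ≤ M) :
    (q.reflect M).eval z⁻¹ * z ^ M = q.eval z := by
  let _ := invertibleOfNonzero hz
  have h := eval₂_reflect_mul_pow (RingHom.id ℂ) z M q hq
  rwa [invOf_eq_inv] at h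

/-- A Szegő quadrature rule on the circle. The integrand `h = G / (z^(N-1) A A*)`, with `A = P.den`
and `A* = P.num`, splits as `p / A + q / (z^(N-1) A*)`. The first term is holomorphic in the disk,
the second one outside of it with the value `0` at infinity, so that the mean of `h` is `p 0`.
At the points `e^(iξ)` with `e^(iΦ(ξ)) = τ`, the zeros of `nodePoly`, the two terms divided by `Φ'`
become `τ p Ã / (z W')` and `q Ã* / W'` with `W = nodePoly`, `Ã = Q.den` and `Ã* = Q.num`, and
Lagrange interpolation sums them to `p 0` and `0`. -/
theorem integral_circle_eq_sum (hN : 2 ≤ N) (hτ : τ ≠ 0) {ι : Type*} {s : Finset ι} {x : ι → ℝ}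
    (hinj : Set.InjOn (fun i => Complex.exp (x i * Complex.I)) s)
    (hcard : s.card = N + P.d + Q.d)
    (hx : ∀ i ∈ s, Complex.exp (phase P Q N (x i) * Complex.I) = τ) {G : ℂ[X]}
    (hG : G.natDegree ≤ 2 * (N - 1 + P.d)) {h : ℝ → ℂ}
    (hh : ∀ t, h t = G.eval (Complex.exp (t * Complex.I)) / (Complex.exp (t * Complex.I) ^ (N - 1)
      * (P.den.eval (Complex.exp (t * Complex.I)) * P.num.eval (Complex.exp (t * Complex.I))))) :
    ∫ t in (0 : ℝ)..2 * Real.pi, h t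
      = 2 * Real.pi * ∑ i ∈ s, h (x i) * (phaseDeriv P Q N (x i) : ℂ)⁻¹ := by
  have hnum : (X ^ (N - 1) * P.num).natDegree = N - 1 + P.d := by
    rw [(monic_X_pow _).natDegree_mul P.num_monic, natDegree_X_pow, natDegree_num]
  obtain ⟨p, q, hpq, hp, hq⟩ := exists_mul_add_mul_eq (k := N - 1 + P.d)
    (P.isCoprime_den_X_pow_mul_num (N - 1)) ((monic_X_pow _).mul P.num_monic).ne_zero
    (by omega) (P.natDegree_den_le.trans (by omega)) (hG.trans (by omega))
  have hdP : ∀ t : ℝ, P.den.eval (Complex.exp (t * Complex.I)) ≠ 0 := fun t =>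
    P.eval_den_ne_zero (Complex.norm_exp_ofReal_mul_I t).le
  have hdQ : ∀ t : ℝ, Q.den.eval (Complex.exp (t * Complex.I)) ≠ 0 := fun t =>
    Q.eval_den_ne_zero (Complex.norm_exp_ofReal_mul_I t).le
  have hnP : ∀ t : ℝ, P.num.eval (Complex.exp (t * Complex.I)) ≠ 0 := fun t =>
    P.eval_num_ne_zero (Complex.norm_exp_ofReal_mul_I t).ge
  have hsplit : ∀ t : ℝ, h t
      = p.eval (Complex.exp (t * Complex.I)) / P.den.eval (Complex.exp (t * Complex.I))
        + q.eval (Complex.exp (t * Complex.I)) / (Complex.exp (t * Complex.I) ^ (N - 1)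
          * P.num.eval (Complex.exp (t * Complex.I))) := fun t => by
    have h1 := hdP t
    have h2 := hnP t
    have h3 := Complex.exp_ne_zero (t * Complex.I)
    rw [hh, ← hpq]
    simp only [eval_add, eval_mul, eval_pow, eval_X]
    field_simp
  have hdiff : ∀ r : ℂ[X], DiffContOnCl ℂ (fun z => r.eval z / P.den.eval z)
      (Metric.ball 0 1) := fun r => by
    apply DifferentiableOn.diffContOnCl
    rw [closure_ball _ one_ne_zero]
    intro z hz
    have h := P.eval_den_ne_zero (by simpa using hz : ‖z‖ ≤ 1)
    exact (r.differentiableAt.div P.den.differentiableAt h).differentiableWithinAt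
  -- the second term is a function of `z⁻¹` that is holomorphic in the unit disk
  have hq' : ∀ t : ℝ, q.eval (Complex.exp (t * Complex.I)) / (Complex.exp (t * Complex.I) ^ (N - 1)
        * P.num.eval (Complex.exp (t * Complex.I)))
      = (q.reflect (N - 1 + P.d)).eval (Complex.exp (t * Complex.I))⁻¹
        / P.den.eval (Complex.exp (t * Complex.I))⁻¹ := fun t => by
    have h3 := Complex.exp_ne_zero (t * Complex.I)
    have h4 : P.den.eval (Complex.exp (t * Complex.I))⁻¹ ≠ 0 :=
      P.eval_den_ne_zero (norm_exp_neg_ofReal_mul_I t).le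
    rw [P.eval_num_eq h3, ← eval_reflect_inv_mul_pow h3 (show q.natDegree ≤ N - 1 + P.d by omega),
      ← mul_assoc, ← pow_add]
    field_simp
  have hint : ∫ t in (0 : ℝ)..2 * Real.pi, h t = 2 * Real.pi * p.eval 0 := by
    have hc1 : Continuous fun t : ℝ => p.eval (Complex.exp (t * Complex.I))
        / P.den.eval (Complex.exp (t * Complex.I)) :=
      (p.continuous.comp (by fun_prop)).div (P.den.continuous.comp (by fun_prop)) hdP
    have hc2 : Continuous fun t : ℝ => q.eval (Complex.exp (t * Complex.I))
        / (Complex.exp (t * Complex.I) ^ (N - 1) * P.num.eval (Complex.exp (t * Complex.I))) :=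
      (q.continuous.comp (by fun_prop)).div
        (Continuous.mul (by fun_prop) (P.num.continuous.comp (by fun_prop)))
        fun t => mul_ne_zero (pow_ne_zero _ (Complex.exp_ne_zero _)) (hnP t)
    have hr0 : (q.reflect (N - 1 + P.d)).eval 0 = 0 := by
      rw [← coeff_zero_eq_eval_zero, coeff_reflect, revAt_le (Nat.zero_le _), Nat.sub_zero]
      exact coeff_eq_zero_of_natDegree_lt (by omega)
    simp_rw [hsplit]
    rw [intervalIntegral.integral_add (hc1.intervalIntegrable _ _) (hc2.intervalIntegrable _ _)]
    simp_rw [hq']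
    rw [integral_exp_mul_I_of_diffContOnCl (hdiff p),
      integral_exp_neg_mul_I_of_diffContOnCl (hdiff (q.reflect (N - 1 + P.d)))]
    simp only [hr0, eval_den_zero]
    ring
  rw [hint]
  congr 1
  have hroot : ∀ i ∈ s, (nodePoly P Q N τ).eval (Complex.exp (x i * Complex.I)) = 0 :=
    fun i hi => by rw [eval_nodePoly, hx i hi, sub_self, mul_zero]
  have hmon := nodePoly_monic P Q τ (N := N) (by omega)
  have hdeg := (natDegree_nodePoly P Q τ (N := N) (by omega)).trans hcard.symm
  have h0 := eval_nodePoly_zero P Q τ (N := N) (by omega)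
  have hsum1 := sum_eval_div_mul_derivative hinj hmon hdeg hroot (q := C τ * (p * Q.den))
    (by rw [h0]; exact neg_ne_zero.2 hτ)
    (lt_of_le_of_lt ((natDegree_C_mul_le _ _).trans
      (natDegree_mul_le_of_le hp Q.natDegree_den_le)) (by omega))
  have hsum2 := sum_eval_div_derivative_eq_zero hinj hmon hdeg hroot (q := q * Q.num)
    (lt_of_le_of_lt (Nat.add_le_add_right
      (natDegree_mul_le_of_le le_rfl Q.natDegree_num.le) 1) (by omega))
  have hval : -((C τ * (p * Q.den)).eval 0 / (nodePoly P Q N τ).eval 0) = p.eval 0 := by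
    rw [h0, eval_mul, eval_mul, eval_C, eval_den_zero]
    field_simp
  rw [← hval, ← hsum1, ← add_zero (∑ i ∈ s, _), ← hsum2, ← Finset.sum_add_distrib]
  refine Finset.sum_congr rfl fun i hi => ?_
  have hder := exp_mul_eval_derivative_nodePoly P Q N τ (hx i hi)
  have hbl := exp_phase_mul_I P Q N (x i)
  rw [hx i hi] at hbl
  have h1 := hdP (x i)
  have h2 := hnP (x i)
  have h3 := Complex.exp_ne_zero (x i * Complex.I)
  have h4 := hdQ (x i)
  have h5 : (phaseDeriv P Q N (x i) : ℂ) ≠ 0 := by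
    exact_mod_cast (phaseDeriv_pos P Q (N := N) (by omega) (x i)).ne'
  have h6 : Q.num.eval (Complex.exp (x i * Complex.I)) ≠ 0 :=
    Q.eval_num_ne_zero (Complex.norm_exp_ofReal_mul_I _).ge
  have hder' : (nodePoly P Q N τ).derivative.eval (Complex.exp (x i * Complex.I))
      = phaseDeriv P Q N (x i) * (Complex.exp (x i * Complex.I) ^ (N - 1)
        * (P.num.eval (Complex.exp (x i * Complex.I))
          * Q.num.eval (Complex.exp (x i * Complex.I)))) := by
    have hpow : Complex.exp (x i * Complex.I) ^ N
        = Complex.exp (x i * Complex.I) ^ (N - 1) * Complex.exp (x i * Complex.I) := by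
      rw [← pow_succ, Nat.sub_add_cancel (by omega)]
    apply mul_left_cancel₀ h3
    rw [hder, mul_assoc, hbl, hpow]
    ring
  rw [hsplit, hder, hder']
  simp only [eval_mul, eval_C]
  field_simp

end BSParams

/-! ### Folding sums, and the integrand as a rational function on the circle -/

/-- The reflection `k ↦ -k - e` maps `[0, m]` onto `[-m - e, -e]`. Together these two intervals
cover `[-m - e, m]`, except that they share the point `0` if `e = 0` and omit `-1` if `e = 2`. -/
theorem sum_Ico_eq_two_mul_sum_range {w : ℤ → ℂ} {e : ℕ} (he : e ≤ 2)
    (hw : ∀ k, w (-k - e) = w k) (hw1 : e = 2 → w (-1) = 0) (m : ℕ) :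
    ∑ k ∈ Finset.Ico (-(m : ℤ) - e) (m + 1), w k
      = 2 * ∑ l ∈ Finset.range (m + 1), w l - if e = 0 then w 0 else 0 := by
  induction m with
  | zero =>
    have h := hw 0
    interval_cases e
    · have h1 : Finset.Ico (-((0 : ℕ) : ℤ) - (0 : ℕ)) ((0 : ℕ) + 1) = {0} := by decide
      rw [h1]; simp; ring
    · have h1 : Finset.Ico (-((0 : ℕ) : ℤ) - (1 : ℕ)) ((0 : ℕ) + 1) = {-1, 0} := by decide
      norm_num at h
      rw [h1]; simp [h]; ring
    · have h1 : Finset.Ico (-((0 : ℕ) : ℤ) - (2 : ℕ)) ((0 : ℕ) + 1) = {-2, -1, 0} := by decide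
      norm_num at h
      rw [h1]; simp [h, hw1]; ring
  | succ m ih =>
    rw [Finset.sum_range_succ, mul_add, add_sub_right_comm, ← ih]
    push_cast
    have h1 : Finset.Ico (-((m : ℤ) + 1) - e) (m + 1 + 1)
        = insert (-((m : ℤ) + 1) - e) (insert ((m : ℤ) + 1)
          (Finset.Ico (-(m : ℤ) - e) (m + 1))) := by
      ext k; simp only [Finset.mem_Ico, Finset.mem_insert]; omega
    rw [h1, Finset.sum_insert (by simp only [Finset.mem_Ico, Finset.mem_insert]; omega),
      Finset.sum_insert (by simp only [Finset.mem_Ico]; omega), hw]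
    ring

theorem sum_half_pow_mul {w : ℕ → ℂ} {A B m : ℕ} (hA : A ≤ 1) (hB : B ≤ 1) (hm : 0 < m) :
    2 * ∑ l ∈ Finset.range (m + 1),
        (1 / 2 : ℂ) ^ (A * (if l = 0 then 1 else 0) + B * (if l = m then 1 else 0)) * w l
      = 2 * ∑ l ∈ Finset.range (m + 1), w l - A * w 0 - B * w m := by
  have h : ∀ l ∈ Finset.range (m + 1),
      (1 / 2 : ℂ) ^ (A * (if l = 0 then 1 else 0) + B * (if l = m then 1 else 0)) * w l
        = w l - (if l = 0 then A / 2 * w 0 else 0) - (if l = m then B / 2 * w m else 0) := by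
    intro l _
    by_cases h0 : l = 0
    · subst h0
      interval_cases A <;> (simp [hm.ne]; try ring)
    · by_cases h1 : l = m
      · subst h1
        interval_cases B <;> (simp [h0]; try ring)
      · simp [h0, h1]
  rw [Finset.sum_congr rfl h, Finset.sum_sub_distrib, Finset.sum_sub_distrib,
    Finset.sum_ite_eq', Finset.sum_ite_eq']
  simp
  ring

/-- The sum over all levels `k` with `ξ_k ∈ (-π, π]`, folded by the reflection onto the levels
`0, …, m` of the nodes. The powers of `1 / 2` account for the nodes `0` and `π`, which are their own
mirror images on the circle. The levels that are not reached by folding are `-1`, if `a = c = 1`, and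
`m + 1`, if `b = d = 1`; they belong to the points `0` and `π`, where the weight function
vanishes. -/
theorem sum_Ico_eq_two_mul_sum_half_pow_mul {w : ℤ → ℂ} {a b c d m : ℕ}
    (ha : a = 0 ∨ a = 1) (hb : b = 0 ∨ b = 1) (hc : c = 0 ∨ c = 1) (hd : d = 0 ∨ d = 1)
    (hm : 0 < m) (hw : ∀ k, w (-k - (a + c : ℕ)) = w k) (hw1 : a = 1 → c = 1 → w (-1) = 0)
    (hw2 : b = 1 → d = 1 → w (m + 1) = 0) :
    ∑ k ∈ Finset.Ico (-(m : ℤ) - (a + c : ℕ) + ((1 - b) * (1 - d) : ℕ)) (m + 1 + (b * d : ℕ)), w k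
      = 2 * ∑ l ∈ Finset.range (m + 1), (1 / 2 : ℂ) ^ ((1 - a) * (1 - c) * (if l = 0 then 1 else 0)
          + (1 - b) * (1 - d) * (if l = m then 1 else 0)) * w l := by
  have hS := sum_Ico_eq_two_mul_sum_range (w := w) (e := a + c) (by omega) hw
    (fun h => hw1 (by omega) (by omega)) m
  have hA : (1 - a) * (1 - c) ≤ 1 := Nat.mul_le_mul (by omega) (by omega) |>.trans_eq (one_mul 1)
  have hB : (1 - b) * (1 - d) ≤ 1 := Nat.mul_le_mul (by omega) (by omega) |>.trans_eq (one_mul 1)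
  have hA' : (((1 - a) * (1 - c) : ℕ) : ℂ) * w 0 = if a + c = 0 then w 0 else 0 := by
    rcases ha with rfl | rfl <;> rcases hc with rfl | rfl <;> simp
  rw [sum_half_pow_mul (w := fun l : ℕ => w l) hA hB hm, Nat.cast_zero, hA', ← hS]
  have hlow : ∑ k ∈ Finset.Ico (-(m : ℤ) - (a + c : ℕ)) (m + 1), w k
      = w m + ∑ k ∈ Finset.Ico (-(m : ℤ) - (a + c : ℕ) + 1) (m + 1), w k := by
    have h1 : Finset.Ico (-(m : ℤ) - (a + c : ℕ)) (m + 1)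
        = insert (-(m : ℤ) - (a + c : ℕ)) (Finset.Ico (-(m : ℤ) - (a + c : ℕ) + 1) (m + 1)) := by
      ext k; simp only [Finset.mem_Ico, Finset.mem_insert]; omega
    rw [h1, Finset.sum_insert (by simp), hw]
  have hhigh : b = 1 → d = 1 → ∑ k ∈ Finset.Ico (-(m : ℤ) - (a + c : ℕ)) (m + 1 + 1), w k
      = ∑ k ∈ Finset.Ico (-(m : ℤ) - (a + c : ℕ)) (m + 1), w k := fun h1 h2 => by
    have h3 : Finset.Ico (-(m : ℤ) - (a + c : ℕ)) (m + 1 + 1)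
        = insert ((m : ℤ) + 1) (Finset.Ico (-(m : ℤ) - (a + c : ℕ)) (m + 1)) := by
      ext k; simp only [Finset.mem_Ico, Finset.mem_insert]; omega
    rw [h3, Finset.sum_insert (by simp), hw2 h1 h2, zero_add]
  rcases hb with rfl | rfl <;> rcases hd with rfl | rfl
  · rw [hlow]; simp
  · simp
  · simp
  · simpa using hhigh rfl rfl

namespace BSParams

variable (P Q : BSParams)

theorem rho_pos {x : ℝ} (h0 : 0 ≤ x) (h1 : x ≤ Real.pi) (hm : P.epsMinus = 1 → 0 < x)
    (hp : P.epsPlus = 1 → x < Real.pi) : 0 < P.rho x := by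
  have h2 : 0 < 1 + (P.epsPlus : ℝ) * Real.cos x := by
    rcases P.epsPlus_mem with h | h
    · simp [h]
    · have := Real.cos_lt_cos_of_nonneg_of_le_pi h0 le_rfl (hp h)
      rw [Real.cos_pi] at this
      rw [h]; push_cast; linarith
  have h3 : 0 < 1 - (P.epsMinus : ℝ) * Real.cos x := by
    rcases P.epsMinus_mem with h | h
    · simp [h]
    · have := Real.cos_lt_cos_of_nonneg_of_le_pi le_rfl h1 (hm h)
      rw [Real.cos_zero] at this
      rw [h]; push_cast; linarith
  unfold rho
  positivity

theorem rho_zero (h : P.epsMinus = 1) : P.rho 0 = 0 := by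
  simp [rho, h]

theorem rho_pi (h : P.epsPlus = 1) : P.rho Real.pi = 0 := by
  simp [rho, h]

theorem ratFun_neg (f : Polynomial ℂ) (x : ℝ) : P.ratFun f (-x) = P.ratFun f x := by
  simp [ratFun]

theorem rho_neg (x : ℝ) : P.rho (-x) = P.rho x := by
  simp [rho]

theorem continuous_ratFun_mul_rho (f : Polynomial ℂ) :
    Continuous fun x => P.ratFun f x * (P.rho x : ℂ) := by
  unfold ratFun rho
  refine Continuous.mul (Continuous.div (f.continuous.comp (by fun_prop)) (by fun_prop) ?_)
    (by fun_prop)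
  exact P.prod_one_add_two_mul_cos_add_sq_ne_zero

open Polynomial in
/-- On the circle, `R ρ` has the form that `integral_circle_eq_sum` integrates. -/
theorem exists_ratFun_mul_rho_eq {f : ℂ[X]} {K : ℕ}
    (hf : f.natDegree + P.epsPlus + P.epsMinus ≤ K + P.d) :
    ∃ G : ℂ[X], G.natDegree ≤ 2 * (K + P.d) ∧ ∀ t : ℝ, P.ratFun f t * (P.rho t : ℂ)
      = G.eval (Complex.exp (t * Complex.I)) / (Complex.exp (t * Complex.I) ^ K
        * (P.den.eval (Complex.exp (t * Complex.I))
          * P.num.eval (Complex.exp (t * Complex.I)))) := by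
  have hb : ∀ (s : ℂ) (ε : ℕ), ε = 0 ∨ ε = 1 →
      (1 + C (s * ε) * X : ℂ[X]).natDegree ≤ ε := fun s ε hε => by
    rcases hε with h | h
    · simp [h]
    · rw [h]; compute_degree
  have hdeg : (f * (C (2 ^ (P.epsPlus + P.epsMinus)) * (1 + C (1 * P.epsPlus : ℂ) * X)
      * (1 + C (-1 * P.epsMinus : ℂ) * X))).natDegree ≤ K + P.d := by
    have h2 := natDegree_mul_le_of_le (natDegree_mul_le_of_le
      (natDegree_C (2 ^ (P.epsPlus + P.epsMinus) : ℂ)).le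
      (hb 1 P.epsPlus P.epsPlus_mem)) (hb (-1) P.epsMinus P.epsMinus_mem)
    exact (natDegree_mul_le_of_le le_rfl h2).trans (by omega)
  obtain ⟨G, hG, hGe⟩ := exists_eval_cos_mul_pow _ (K + P.d) hdeg
  refine ⟨G, hG, fun t => ?_⟩
  rw [← hGe, ← prod_one_add_two_mul_cos_add_sq, ratFun, rho]
  have h1 := P.prod_one_add_two_mul_cos_add_sq_ne_zero t
  have h2 := Complex.exp_ne_zero (t * Complex.I)
  simp only [eval_mul, eval_add, eval_C, eval_X, eval_one]
  push_cast at h1 ⊢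
  rw [pow_add]
  generalize (∏ r, (1 + 2 * P.α r * Complex.cos t + P.α r ^ 2)) = D at h1 ⊢
  generalize Complex.exp (t * Complex.I) = z at h2 ⊢
  field_simp
  ring

/-- The coefficient `2 (m - d_ε - d̃_ε̃)` is an integer `N ≥ 2`. The Blaschke product of the phase
has degree `N + d + d̃ = 2 m + ε₊ + ε₋ + ε̃₊ + ε̃₋`. -/
theorem exists_exponent {m : ℕ} (hPQ : ⌈P.dEps⌉ + ⌈Q.dEps⌉ < (m : ℤ)) :
    ∃ N : ℕ, 2 ≤ N ∧ N + P.d + Q.d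
        = 2 * m + P.epsPlus + P.epsMinus + Q.epsPlus + Q.epsMinus ∧
      (N : ℝ) = 2 * ((m : ℝ) - P.dEps - Q.dEps) := by
  have h1 := Int.le_ceil P.dEps
  have h2 := Int.le_ceil Q.dEps
  have h3 : ((⌈P.dEps⌉ : ℝ) + ⌈Q.dEps⌉ + 1) ≤ m := by exact_mod_cast hPQ
  have h4 : ((2 + P.d + Q.d : ℕ) : ℝ)
      ≤ (2 * m + P.epsPlus + P.epsMinus + Q.epsPlus + Q.epsMinus : ℕ) := by
    push_cast
    unfold dEps at *
    linarith
  have h5 := Nat.cast_le.1 h4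
  obtain ⟨N, hN⟩ := Nat.exists_eq_add_of_le h5
  refine ⟨2 + N, by omega, by omega, ?_⟩
  have h6 := congrArg (Nat.cast (R := ℝ)) hN
  push_cast at h6 ⊢
  unfold dEps
  linarith

theorem isNode_iff {m N : ℕ} (hN : (N : ℝ) = 2 * ((m : ℝ) - P.dEps - Q.dEps)) (l : ℕ) (x : ℝ) :
    IsNode P Q m l x ↔ phase P Q N x = Real.pi * (2 * l + P.epsMinus + Q.epsMinus) := by
  rw [IsNode, sum_integral_bsU, sum_integral_bsU, ← hN, phase]
  exact_mod_cast Iff.rfl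

theorem christoffelWeight_eq {m N : ℕ} (hN : (N : ℝ) = 2 * ((m : ℝ) - P.dEps - Q.dEps)) (l : ℕ)
    (x : ℝ) : christoffelWeight P Q m l x
      = (1 / 2) ^ ((1 - P.epsMinus) * (1 - Q.epsMinus) * (if l = 0 then 1 else 0)
        + (1 - P.epsPlus) * (1 - Q.epsPlus) * (if l = m then 1 else 0))
        * (phaseDeriv P Q N x : ℂ)⁻¹ := by
  rw [christoffelWeight, sum_bsU, sum_bsU, ← hN, phaseDeriv]
  push_cast
  rfl

end BSParams

/-! ### The nodes and quadrature on the half circle -/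

namespace BSParams

variable (P Q : BSParams)

/-- The solution of `Φ(ξ) = π (2 k + ε₋ + ε̃₋)`, for an arbitrary integer level `k`. -/
def node {N : ℕ} (hN : 0 < N) (k : ℤ) : ℝ :=
  (surjective_phase P Q hN (Real.pi * (2 * k + P.epsMinus + Q.epsMinus))).choose

variable {P Q} {N : ℕ} (hN : 0 < N)

theorem phase_node (k : ℤ) :
    phase P Q N (node P Q hN k) = Real.pi * (2 * k + P.epsMinus + Q.epsMinus) :=
  (surjective_phase P Q hN (Real.pi * (2 * k + P.epsMinus + Q.epsMinus))).choose_spec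

theorem eq_node_iff (k : ℤ) (x : ℝ) :
    x = node P Q hN k ↔ phase P Q N x = Real.pi * (2 * k + P.epsMinus + Q.epsMinus) := by
  rw [← phase_node hN, (strictMono_phase P Q hN).injective.eq_iff]

theorem strictMono_node : StrictMono (node P Q hN) := fun k l hkl => by
  rw [← (strictMono_phase P Q hN).lt_iff_lt, phase_node, phase_node]
  have : (k : ℝ) < l := by exact_mod_cast hkl
  exact mul_lt_mul_of_pos_left (by linarith) Real.pi_pos

theorem node_neg_sub (k : ℤ) :
    node P Q hN (-k - (P.epsMinus + Q.epsMinus : ℕ)) = -node P Q hN k := by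
  symm
  rw [eq_node_iff, phase_neg, phase_node]
  push_cast
  ring

theorem exp_phase_node_mul_I (k : ℤ) :
    Complex.exp (phase P Q N (node P Q hN k) * Complex.I)
      = Complex.exp ((Real.pi * (P.epsMinus + Q.epsMinus) : ℝ) * Complex.I) := by
  rw [phase_node, Complex.exp_eq_exp_iff_exists_int]
  exact ⟨k, by push_cast; ring⟩

theorem lt_node_iff (k : ℤ) (x : ℝ) :
    x < node P Q hN k ↔ phase P Q N x < Real.pi * (2 * k + P.epsMinus + Q.epsMinus) := by
  rw [← phase_node hN, (strictMono_phase P Q hN).lt_iff_lt]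

theorem node_le_iff (k : ℤ) (x : ℝ) :
    node P Q hN k ≤ x ↔ Real.pi * (2 * k + P.epsMinus + Q.epsMinus) ≤ phase P Q N x := by
  rw [← phase_node hN, (strictMono_phase P Q hN).le_iff_le]

theorem zero_lt_node_iff (k : ℤ) :
    0 < node P Q hN k ↔ 0 < 2 * k + P.epsMinus + Q.epsMinus := by
  rw [lt_node_iff, phase_zero, mul_pos_iff_of_pos_left Real.pi_pos]
  exact_mod_cast Iff.rfl

theorem node_eq_zero_iff (k : ℤ) :
    node P Q hN k = 0 ↔ 2 * k + P.epsMinus + Q.epsMinus = 0 := by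
  rw [eq_comm, eq_node_iff, phase_zero, eq_comm, mul_eq_zero_iff_left Real.pi_pos.ne']
  exact_mod_cast Iff.rfl

theorem node_le_pi_iff (k : ℤ) :
    node P Q hN k ≤ Real.pi ↔ 2 * k + P.epsMinus + Q.epsMinus ≤ (N + P.d + Q.d : ℕ) := by
  rw [node_le_iff, phase_pi, mul_le_mul_iff_right₀ Real.pi_pos]
  exact_mod_cast Iff.rfl

theorem node_eq_pi_iff (k : ℤ) :
    node P Q hN k = Real.pi ↔ 2 * k + P.epsMinus + Q.epsMinus = (N + P.d + Q.d : ℕ) := by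
  rw [eq_comm, eq_node_iff, phase_pi, eq_comm, mul_right_inj' Real.pi_pos.ne']
  exact_mod_cast Iff.rfl

theorem neg_pi_lt_node_iff (k : ℤ) :
    -Real.pi < node P Q hN k ↔ -((N + P.d + Q.d : ℕ) : ℤ) < 2 * k + P.epsMinus + Q.epsMinus := by
  rw [lt_node_iff, phase_neg, phase_pi, ← mul_neg, mul_lt_mul_iff_right₀ Real.pi_pos]
  exact_mod_cast Iff.rfl

theorem injOn_exp_node {s : Set ℤ}
    (hs : ∀ k ∈ s, -Real.pi < node P Q hN k ∧ node P Q hN k ≤ Real.pi) :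
    Set.InjOn (fun k => Complex.exp (node P Q hN k * Complex.I)) s := fun k hk l hl h => by
  have h1 := Complex.exp_inj_of_neg_pi_lt_of_le_pi (by simpa using (hs k hk).1)
    (by simpa using (hs k hk).2) (by simpa using (hs l hl).1) (by simpa using (hs l hl).2) h
  have h2 := mul_right_cancel₀ Complex.I_ne_zero h1
  exact (strictMono_node hN).injective (by exact_mod_cast h2)

/-- The quadrature rule on `[0, π]`, folded from the rule on the circle. -/
theorem integral_ratFun_mul_rho {m : ℕ} (hm : 0 < m) (hN2 : 2 ≤ N) (hNd : N + P.d + Q.d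
      = 2 * m + P.epsPlus + P.epsMinus + Q.epsPlus + Q.epsMinus) {f : Polynomial ℂ}
    (hf : f.natDegree + P.epsPlus + P.epsMinus ≤ N - 1 + P.d) :
    (1 / (2 * (Real.pi : ℂ))) * ∫ x in (0 : ℝ)..Real.pi, P.ratFun f x * (P.rho x : ℂ)
      = ∑ l ∈ Finset.range (m + 1), (1 / 2 : ℂ) ^
          ((1 - P.epsMinus) * (1 - Q.epsMinus) * (if l = 0 then 1 else 0)
            + (1 - P.epsPlus) * (1 - Q.epsPlus) * (if l = m then 1 else 0))
          * (P.ratFun f (node P Q hN l) * (P.rho (node P Q hN l) : ℂ)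
            * (phaseDeriv P Q N (node P Q hN l) : ℂ)⁻¹) := by
  obtain ⟨G, hG, hGe⟩ := P.exists_ratFun_mul_rho_eq hf
  have ha := P.epsMinus_mem
  have hb := P.epsPlus_mem
  have hc := Q.epsMinus_mem
  have hd := Q.epsPlus_mem
  have hbd : (P.epsPlus * Q.epsPlus : ℕ) + 1
      = P.epsPlus + Q.epsPlus + (1 - P.epsPlus) * (1 - Q.epsPlus) := by
    rcases hb with h | h <;> rcases hd with h' | h' <;> simp [h, h']
  have hB : (1 - P.epsPlus) * (1 - Q.epsPlus) ≤ 1 - P.epsPlus :=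
    (Nat.mul_le_mul_left _ (Nat.sub_le 1 _)).trans_eq (mul_one _)
  have hB' : P.epsPlus * Q.epsPlus ≤ P.epsPlus := by
    rcases hd with h' | h' <;> simp [h']
  -- the levels of the points of `(-π, π]`: the lower end is raised when `π` is a node, to drop
  -- `-π`, and the upper end when `π` is a zero of `e^(iΦ) = τ` that is not a node
  set K := Finset.Ico (-(m : ℤ) - (P.epsMinus + Q.epsMinus : ℕ)
    + ((1 - P.epsPlus) * (1 - Q.epsPlus) : ℕ)) (m + 1 + (P.epsPlus * Q.epsPlus : ℕ)) with hK
  have hrange : ∀ k ∈ (K : Set ℤ), -Real.pi < node P Q hN k ∧ node P Q hN k ≤ Real.pi := by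
    intro k hk
    rw [neg_pi_lt_node_iff, node_le_pi_iff]
    rw [hK, Finset.mem_coe, Finset.mem_Ico] at hk
    generalize (1 - P.epsPlus) * (1 - Q.epsPlus) = B at *
    generalize P.epsPlus * Q.epsPlus = B' at *
    omega
  have hcard : K.card = N + P.d + Q.d := by
    rw [hK, Int.card_Ico]
    generalize (1 - P.epsPlus) * (1 - Q.epsPlus) = B at *
    generalize P.epsPlus * Q.epsPlus = B' at *
    omega
  have hquad := integral_circle_eq_sum P Q hN2 (Complex.exp_ne_zero _)
    (injOn_exp_node hN hrange) hcard (fun k _ => exp_phase_node_mul_I hN k) hG hGe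
  rw [integral_zero_pi_of_even_of_periodic (P.continuous_ratFun_mul_rho f)
      (fun x => by rw [ratFun_neg, rho_neg])
      (fun x => by simp only [ratFun, rho, Real.cos_add_two_pi]),
    sum_Ico_eq_two_mul_sum_half_pow_mul ha hb hc hd hm
      (fun k => by rw [node_neg_sub, ratFun_neg, rho_neg, phaseDeriv_neg])] at hquad
  · have hpi : (Real.pi : ℂ) ≠ 0 := by exact_mod_cast Real.pi_ne_zero
    have h2 := mul_left_cancel₀ two_ne_zero (hquad.trans (mul_assoc _ _ _))
    rw [h2]
    field_simp
  · intro h1 h2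
    rw [(node_eq_zero_iff hN (-1)).2 (by rw [h1, h2]; norm_num), P.rho_zero h1]
    simp
  · intro h1 h2
    rw [(node_eq_pi_iff hN (m + 1)).2 (by rw [hNd, h1, h2]; push_cast; ring), P.rho_pi h1]
    simp

end BSParams

end

theorem theorem5p1 (P Q : BSParams) (m : ℕ) (hm : 0 < m)
    (hPQ : ⌈P.dEps⌉ + ⌈Q.dEps⌉ < (m : ℤ)) :
    ∃ ξ : Fin (m + 1) → ℝ,
      -- the nodes are the unique real solutions of the transcendental equations
      (∀ (l : Fin (m + 1)) (x : ℝ), IsNode P Q m l x ↔ x = ξ l) ∧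
      -- they are distinct and ordered in `[0, π]`, with known boundary nodes
      0 ≤ ξ 0 ∧ StrictMono ξ ∧ ξ (Fin.last m) ≤ Real.pi ∧
      (ξ 0 = 0 ↔ P.epsMinus = 0 ∧ Q.epsMinus = 0) ∧
      (ξ (Fin.last m) = Real.pi ↔ P.epsPlus = 0 ∧ Q.epsPlus = 0) ∧
      -- positivity of the rule
      (∀ l : Fin (m + 1), (christoffelWeight P Q m l (ξ l)).im = 0 ∧
        0 < (christoffelWeight P Q m l (ξ l)).re ∧ 0 < P.rho (ξ l)) ∧
      -- exactness
      ∀ f : Polynomial ℂ, (f.natDegree : ℝ) ≤ 2 * ((m : ℝ) - Q.dEps) - 1 →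
        IntervalIntegrable (fun x => P.ratFun f x * (P.rho x : ℂ)) MeasureTheory.volume
          0 Real.pi ∧
        (1 / (2 * (Real.pi : ℂ))) * ∫ x in (0 : ℝ)..Real.pi, P.ratFun f x * (P.rho x : ℂ)
          = ∑ l : Fin (m + 1),
              P.ratFun f (ξ l) * (P.rho (ξ l) : ℂ) * christoffelWeight P Q m l (ξ l) := by
  obtain ⟨N, hN2, hNd, hNr⟩ := BSParams.exists_exponent P Q hPQ
  have hN : 0 < N := by omega
  have hmono : StrictMono fun l : Fin (m + 1) => BSParams.node P Q hN (l : ℕ) :=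
    fun k l hkl => BSParams.strictMono_node hN (by exact_mod_cast hkl)
  have h0 : 0 ≤ BSParams.node P Q hN ((0 : Fin (m + 1)) : ℕ) := by
    rcases (Nat.zero_le (P.epsMinus + Q.epsMinus)).eq_or_lt with h | h
    · exact ((BSParams.node_eq_zero_iff hN _).2 (by simp; omega)).ge
    · exact ((BSParams.zero_lt_node_iff hN _).2 (by simp; omega)).le
  have hlast : BSParams.node P Q hN ((Fin.last m : Fin (m + 1)) : ℕ) ≤ Real.pi := by
    rw [BSParams.node_le_pi_iff]; simp only [Fin.val_last]; omega
  refine ⟨fun l => BSParams.node P Q hN (l : ℕ), fun l x => ?_, h0, hmono, hlast, ?_, ?_,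
    fun l => ?_, fun f hf => ⟨(P.continuous_ratFun_mul_rho f).intervalIntegrable _ _, ?_⟩⟩
  · rw [BSParams.eq_node_iff, BSParams.isNode_iff P Q hNr]
    simp
  · rw [BSParams.node_eq_zero_iff]
    simp only [Fin.val_zero]
    omega
  · rw [BSParams.node_eq_pi_iff]
    simp only [Fin.val_last]
    omega
  · have hw : christoffelWeight P Q m l (BSParams.node P Q hN (l : ℕ))
        = (((1 / 2) ^ ((1 - P.epsMinus) * (1 - Q.epsMinus) * (if (l : ℕ) = 0 then 1 else 0)
        + (1 - P.epsPlus) * (1 - Q.epsPlus) * (if (l : ℕ) = m then 1 else 0))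
        * (BSParams.phaseDeriv P Q N (BSParams.node P Q hN (l : ℕ)))⁻¹ : ℝ) : ℂ) := by
      rw [BSParams.christoffelWeight_eq P Q hNr]
      push_cast
      rfl
    have hpos := BSParams.phaseDeriv_pos P Q hN (BSParams.node P Q hN (l : ℕ))
    refine ⟨by rw [hw, Complex.ofReal_im], by rw [hw, Complex.ofReal_re]; positivity,
      P.rho_pos (h0.trans (hmono.monotone (Fin.zero_le l)))
        ((hmono.monotone (Fin.le_last l)).trans hlast) (fun h => ?_) (fun h => ?_)⟩
    · exact (BSParams.zero_lt_node_iff hN _).2 (by omega)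
    · refine lt_of_le_of_ne ((hmono.monotone (Fin.le_last l)).trans hlast) fun h' => ?_
      have h'' := (BSParams.node_eq_pi_iff hN _).1 h'
      have := l.is_lt
      omega
  · have hf' : f.natDegree + P.epsPlus + P.epsMinus ≤ N - 1 + P.d := by
      have h1 : ((f.natDegree + P.epsPlus + P.epsMinus + 1 : ℕ) : ℝ) ≤ (N + P.d : ℕ) := by
        push_cast
        rw [hNr]
        unfold BSParams.dEps at *
        linarith
      have h2 := Nat.cast_le.1 h1
      omega
    rw [BSParams.integral_ratFun_mul_rho hN hm hN2 hNd hf', Finset.sum_range]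
    refine Finset.sum_congr rfl fun l _ => ?_
    rw [BSParams.christoffelWeight_eq P Q hNr]
    ring
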